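/- Let $k\subset K$ be an extension of fields. A two-sided vector space is a $K\otimes_k K$-module (a $k$-central $K$-$K$-bimodule) $V$ that is finite-dimensional over the left copy of $K$; $\varphi:K\to\operatorname{End}_K(V)$, $\varphi(x)v=v\cdot x$, denotes the right action. For a commutative $K$-algebra $R$, the module $R\otimes_K V$ (formed with the left $K$-structure) is an $R\otimes_k K$-module via $(r\otimes x)(s\otimes v)=rs\otimes v\cdot x$. Consider free rank $m$ direct summands $M$ of the $R$-module $R\otimes_K V$. Such an $M$ is $\varphi$-invariant if it is an $R\otimes_k K$-submodule, and it is generated by $\varphi$-invariants if the image of $\bigwedge^m_R M$ in $\bigwedge^m_R(R\otimes_K V)\cong R\otimes_K\bigwedge^m_K V$ is generated by an element of the form $\sum_i r_i\otimes v_{i1}\wedge\cdots\wedge v_{im}$, where for each $i$ the vectors $v_{i1},\dots,v_{im}$ form a basis of an $m$-dimensional two-sided subspace of $V$. Write $G_\varphi(m,V)(R)$ for the set of those $M$ that are generated by $\varphi$-invariants, and $H_\varphi(m,V)(R)$ for the set of those that are moreover $\varphi$-invariant. For a simple two-sided vector space $T$, call $V$ $T$-homogeneous if all its composition factors are isomorphic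 to $T$, and let $V_T$ be the largest $T$-homogeneous two-sided subspace of $V$. For a two-sided vector space $W$ let $q_T$ be the multiplicity of $T$ as a composition factor of $W$. The $R$-points of $G_\varphi([W],V)$ are the tuples $(M_T)_T$, indexed by the isomorphism classes of simple $K\otimes_k K$-modules, with $M_T\in G_\varphi(q_T\dim_K T,V_T)(R)$ (where $q_T\dim_K T$ means $0$ if $q_T=0$); there are no points if $W$ has a composition factor that is not one of $V$. The set $H_\varphi([W],V)(R)$ is defined in the same way with $H$ in place of $G$. To a tuple belongs the submodule $\bigoplus_T M_T\subset R\otimes_K V$. Theorem. Let $V$ be a two-sided vector space, let $S$ be a simple two-sided vector space and put $m=\dim_K S$. Assume that $|k|>m$, that $K$ is perfect, and that $F/K$ is a field extension. (1) If $V$ is $S$-homogeneous, then every free rank $m$ direct summand $M$ of $F\otimes_K V$ that is generated by $\varphi$-invariants (that is, every free rank $[S]$ family over $\operatorname{Spec}F$ generated by $\varphi$-invariants) is an $F\otimes_k K$-submodule, and $M\cong F\otimes_K S$ as $F\otimes_k K$-modules. (2) For arbitrary $V$, the submodule $\bigoplus_T M_T$ of $F\otimes_K V$ belonging to any $F$-point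 of $G_\varphi([S],V)$ is an $F\otimes_k K$-submodule isomorphic to $F\otimes_K S$ as an $F\otimes_k K$-module. (3) The same holds for every $F$-point of $H_\varphi([S],V)$. -/

import Mathlib

open scoped TensorProduct

namespace TwoSided

/-! A two-sided vector space over `k ⊂ K` is a `K ⊗[k] K`-module `V` of finite dimension over the
left copy of `K`; the left scalar multiplication is `Module K V` with
`IsScalarTower K (K ⊗[k] K) V`, and the right multiplication by `x` is `v ↦ (1 ⊗ₜ x) • v`. -/

section Action

universe u₁ u₂ u₃ u₄

variable (k : Type u₁) (K : Type u₂) [Field k] [Field K] [Algebra k K]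
variable (V : Type u₃) [AddCommGroup V] [Module K V] [Module (K ⊗[k] K) V]
  [IsScalarTower K (K ⊗[k] K) V]

/-- The ring homomorphism `φ : K → End_K V` giving the right action, `φ x v = v · x`. -/
noncomputable def phi : K →+* Module.End K V :=
  (Algebra.lsmul K K V : (K ⊗[k] K) →ₐ[K] Module.End K V).toRingHom.comp
    (Algebra.TensorProduct.includeRight : K →ₐ[k] K ⊗[k] K).toRingHom

theorem phi_apply (x : K) (v : V) : phi k K V x v = ((1 : K) ⊗ₜ[k] x) • v := rfl

theorem phi_algebraMap (c : k) (v : V) :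
    phi k K V (algebraMap k K c) v = (algebraMap k K c) • v := by
  rw [phi_apply, Algebra.algebraMap_eq_smul_one, ← TensorProduct.smul_tmul,
    ← algebraMap_smul (K ⊗[k] K) (c • (1 : K)) v]
  rfl

variable (R : Type u₄) [CommRing R] [Algebra k R] [Algebra K R] [IsScalarTower k K R]

/-- The right action of `K` on the `R`-module `R ⊗[K] V`. -/
noncomputable def phiBaseChange : K →ₐ[k] Module.End R (R ⊗[K] V) where
  toRingHom := (Module.End.baseChangeHom K R V).toRingHom.comp (phi k K V)
  commutes' c := by
    refine LinearMap.ext fun y => ?_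
    induction y with
    | zero => simp
    | add a b ha hb => rw [map_add, ha, hb, map_add]
    | tmul r v =>
      change r ⊗ₜ[K] (phi k K V (algebraMap k K c) v) = c • (r ⊗ₜ[K] v)
      rw [phi_algebraMap, TensorProduct.tmul_smul, algebraMap_smul]

/-- The ring homomorphism `R ⊗[k] K → End_R (R ⊗[K] V)` that combines the two actions. -/
noncomputable def actionHom : R ⊗[k] K →ₐ[R] Module.End R (R ⊗[K] V) :=
  Algebra.TensorProduct.lift (Algebra.ofId R _) (phiBaseChange k K V R)
    (fun r _ => show Commute (Algebra.ofId R _ r) _ from Algebra.commutes r _)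

/-- `R ⊗[K] V` is an `R ⊗[k] K`-module: `(r ⊗ x) • (s ⊗ v) = (r * s) ⊗ (v · x)`. -/
noncomputable instance baseChangeModule : Module (R ⊗[k] K) (R ⊗[K] V) :=
  Module.compHom (R ⊗[K] V) (actionHom k K V R).toRingHom

theorem tmul_smul_tmul (r s : R) (x : K) (v : V) :
    (r ⊗ₜ[k] x) • (s ⊗ₜ[K] v) = (r * s) ⊗ₜ[K] (((1 : K) ⊗ₜ[k] x) • v) := by
  change actionHom k K V R (r ⊗ₜ[k] x) (s ⊗ₜ[K] v) = _
  rw [actionHom, Algebra.TensorProduct.lift_tmul]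
  change r • (s ⊗ₜ[K] (phi k K V x v)) = _
  rw [TensorProduct.smul_tmul', phi_apply, smul_eq_mul]

instance baseChange_isScalarTower : IsScalarTower R (R ⊗[k] K) (R ⊗[K] V) where
  smul_assoc r a y := by
    change actionHom k K V R (r • a) y = r • actionHom k K V R a y
    rw [map_smul]; rfl

end Action

section Families

universe u₁ u₂ u₃ u₄

variable (k : Type u₁) (K : Type u₂) [Field k] [Field K] [Algebra k K]
variable (V : Type u₃) [AddCommGroup V] [Module K V]
variable (R : Type u₄) [CommRing R] [Algebra K R]

/-- The `R`-points of the Grassmannian: free rank `m` direct summands of `R ⊗[K] V`. -/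
def grassmannian (m : ℕ) : Set (Submodule R (R ⊗[K] V)) :=
  {M | Nonempty (Module.Basis (Fin m) R M) ∧ ∃ N, IsCompl M N}

variable [Module (K ⊗[k] K) V] [IsScalarTower K (K ⊗[k] K) V]

/-- `v 0, …, v (m - 1)` is a `K`-basis of a two-sided (that is, `φ`-invariant) subspace of `V`. -/
def IsBasisOfInvariant {m : ℕ} (v : Fin m → V) : Prop :=
  LinearIndependent K v ∧
    ∃ U : Submodule (K ⊗[k] K) V, U.restrictScalars K = Submodule.span K (Set.range v)

/-- `M` is generated by `φ`-invariants: the image of `⋀^m M` is generated by an element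
`∑ i, r i ⊗ (v i 0 ∧ ⋯ ∧ v i (m - 1))` where each `v i` is a basis of a rank `m` invariant subspace.
Here `R ⊗[K] ⋀^m V` is identified with `⋀^m (R ⊗[K] V)` in the canonical way, under which
`r ⊗ (v 0 ∧ ⋯ ∧ v (m - 1))` is `r • ((1 ⊗ v 0) ∧ ⋯ ∧ (1 ⊗ v (m - 1)))`. -/
def GeneratedByInvariants (m : ℕ) (M : Submodule R (R ⊗[K] V)) : Prop :=
  ∃ (N : ℕ) (r : Fin N → R) (v : Fin N → Fin m → V),
    (∀ i, IsBasisOfInvariant k K V (v i)) ∧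
    LinearMap.range (exteriorPower.map m (M := M) (N := R ⊗[K] V) M.subtype) =
      Submodule.span R {∑ i, r i • exteriorPower.ιMulti R m (fun j => (1 : R) ⊗ₜ[K] v i j)}

/-- The `R`-points of `G_{im φ}(m, V)`: free rank `m` families generated by `φ`-invariants. -/
def gFamilies (m : ℕ) : Set (Submodule R (R ⊗[K] V)) :=
  {M | M ∈ grassmannian K V R m ∧ GeneratedByInvariants k K V R m M}

variable [Algebra k R] [IsScalarTower k K R]

/-- The `R`-points of `F_{im φ}(m, V)`: free rank `m` families that are `R ⊗[k] K`-submodules. -/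
def fFamilies (m : ℕ) : Set (Submodule R (R ⊗[K] V)) :=
  {M | M ∈ grassmannian K V R m ∧
    ∃ N : Submodule (R ⊗[k] K) (R ⊗[K] V), N.restrictScalars R = M}

/-- The `R`-points of `H_{im φ}(m, V)`, the fibre product of `F_{im φ}(m, V)` and
`G_{im φ}(m, V)` over the Grassmannian. -/
def hFamilies (m : ℕ) : Set (Submodule R (R ⊗[K] V)) :=
  fFamilies k K V R m ∩ gFamilies k K V R m

end Families

section Homogeneous

universe v₁ v₂ v₃

variable (A : Type v₁) [CommRing A] (S : Type v₂) [AddCommGroup S] [Module A S]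
variable (V : Type v₃) [AddCommGroup V] [Module A V]

/-- `V` is `S`-homogeneous: every simple subquotient of `V` is isomorphic to `S`. -/
def IsHomogeneous : Prop :=
  ∀ (P : Submodule A V) (Q : Submodule A (V ⧸ P)), IsSimpleModule A Q → Nonempty (Q ≃ₗ[A] S)

/-- The `S`-homogeneous component of `V`, the largest `S`-homogeneous submodule. -/
def homogeneousComponent : Submodule A V :=
  sSup {U : Submodule A V | IsHomogeneous A S U}

/-- The multiplicity of `A ⧸ 𝔪` among the composition factors of a finite length module `V`. The
modules `A ⧸ 𝔪`, with `𝔪` maximal, represent the simple `A`-modules up to isomorphism. -/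
noncomputable def multiplicity (𝔪 : MaximalSpectrum A) : ℕ :=
  (Module.length A (homogeneousComponent A (A ⧸ 𝔪.asIdeal) V)).toNat

end Homogeneous

section Points

universe u₁ u₂ u₃ u₄ u₅

variable (k : Type u₁) (K : Type u₂) [Field k] [Field K] [Algebra k K]
variable (W : Type u₅) [AddCommGroup W] [Module (K ⊗[k] K) W]
variable (V : Type u₃) [AddCommGroup V] [Module K V] [Module (K ⊗[k] K) V]
  [IsScalarTower K (K ⊗[k] K) V]
variable (R : Type u₄) [CommRing R] [Algebra K R]

/-- The homogeneous component of `V` of type `(K ⊗[k] K) ⧸ 𝔪`. -/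
abbrev component (𝔪 : MaximalSpectrum (K ⊗[k] K)) : Submodule (K ⊗[k] K) V :=
  homogeneousComponent (K ⊗[k] K) ((K ⊗[k] K) ⧸ 𝔪.asIdeal) V

/-- The left dimension `q * m` of the part of type `T = (K ⊗[k] K) ⧸ 𝔪` of `[W]`, where `q` is the
multiplicity of `T` in `W` and `m` is the left dimension of `T`. -/
noncomputable def rankPart (𝔪 : MaximalSpectrum (K ⊗[k] K)) : ℕ :=
  multiplicity (K ⊗[k] K) W 𝔪 * Module.finrank K ((K ⊗[k] K) ⧸ 𝔪.asIdeal)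

/-- The `R`-points of `G_φ([W], V)`, the product over the homogeneous components `V_𝔪` of `V` of the
`G_{im φ_𝔪}(q_𝔪 m_𝔪, V_𝔪)`; empty if `W` has a composition factor that `V` does not have. -/
def gPoints : Set (∀ 𝔪 : MaximalSpectrum (K ⊗[k] K), Submodule R (R ⊗[K] component k K V 𝔪)) :=
  {M | (∀ 𝔪, multiplicity (K ⊗[k] K) W 𝔪 ≠ 0 → multiplicity (K ⊗[k] K) V 𝔪 ≠ 0) ∧
    ∀ 𝔪, M 𝔪 ∈ gFamilies k K (component k K V 𝔪) R (rankPart k K W 𝔪)}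

/-- The `R`-points of `H_φ([W], V)`. -/
def hPoints [Algebra k R] [IsScalarTower k K R] :
    Set (∀ 𝔪 : MaximalSpectrum (K ⊗[k] K), Submodule R (R ⊗[K] component k K V 𝔪)) :=
  {M | (∀ 𝔪, multiplicity (K ⊗[k] K) W 𝔪 ≠ 0 → multiplicity (K ⊗[k] K) V 𝔪 ≠ 0) ∧
    ∀ 𝔪, M 𝔪 ∈ hFamilies k K (component k K V 𝔪) R (rankPart k K W 𝔪)}

/-- The submodule `⨁ M_𝔪` of `R ⊗[K] V` that belongs to a tuple of submodules
`M_𝔪 ⊂ R ⊗[K] V_𝔪`. -/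
noncomputable def total
    (M : ∀ 𝔪 : MaximalSpectrum (K ⊗[k] K), Submodule R (R ⊗[K] component k K V 𝔪)) :
    Submodule R (R ⊗[K] V) :=
  ⨆ 𝔪, (M 𝔪).map (((component k K V 𝔪).subtype.restrictScalars K).baseChange R)

variable (S : Type u₅) [AddCommGroup S] [Module K S] [Module (K ⊗[k] K) S]
  [IsScalarTower K (K ⊗[k] K) S]

/-- `M ⊂ R ⊗[K] V` is an `R ⊗[k] K`-submodule and is isomorphic, as an `R ⊗[k] K`-module, to
`R ⊗[K] S`. -/
def IsoBaseChange [Algebra k R] [IsScalarTower k K R] (M : Submodule R (R ⊗[K] V)) : Prop :=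
  ∃ N : Submodule (R ⊗[k] K) (R ⊗[K] V),
    N.restrictScalars R = M ∧ Nonempty (N ≃ₗ[R ⊗[k] K] R ⊗[K] S)

end Points

end TwoSided

open scoped TensorProduct

/-! Put `m = dim S`. In an `S`-homogeneous `V` every `m`-dimensional invariant subspace is
isomorphic to `S`, so `a : F ⊗[k] K` acts on the top exterior power of its base change by the same
scalar `d a`, the determinant of `a` on `F ⊗[K] S`. The line `⋀^m M` is generated by a combination
of such powers, so `a` acts on it by `d a` too. For a unit `a` the scalar is nonzero, so `a`
preserves the line and hence `M`; units `1 ⊗ x` suffice for invariance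
(`exists_restrictScalars_eq_of_gFamilies`).

For the isomorphism, write `S ≅ L`, a residue field of `K ⊗[k] K`. Then `B = F ⊗[K] L` is a quotient
of `F ⊗[k] K`, finite over `F` and reduced because `K` is perfect. If `a` is injective on `M`, then
`d a ≠ 0`, so `a` is a unit in `B`. By Nakayama, `P M ≠ M` for every maximal ideal `P` coming from
`B`. The Chinese remainder theorem and a dimension count then show that `M` is cyclic with the
annihilator of `B` (`exists_generator`), so `M ≅ B ≅ F ⊗[K] S`.

For general `V`, only the component of type `S` contributes, and it is homogeneous. -/

namespace TwoSided

/-! ### Exterior powers: decomposable vectors and determinants -/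

section ExteriorPower

variable {F E : Type*} [Field F] [AddCommGroup E] [Module F E]

theorem linearIndependent_map_basis {E' : Type*} [AddCommGroup E'] [Module F E'] {ι : Type*}
    (b : Module.Basis ι F E') (f : E' →ₗ[F] E) (hf : Function.Injective f) :
    LinearIndependent F (fun j => f (b j)) :=
  b.linearIndependent.map' f (LinearMap.ker_eq_bot.mpr hf)

theorem linearIndependent_coe_basis {M : Submodule F E} {ι : Type*} (b : Module.Basis ι F M) :
    LinearIndependent F (fun j => (b j : E)) :=
  linearIndependent_map_basis b M.subtype M.subtype_injective

theorem span_range_coe_basis {M : Submodule F E} {ι : Type*} (b : Module.Basis ι F M) :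
    Submodule.span F (Set.range fun j => (b j : E)) = M := by
  have := congrArg (Submodule.map M.subtype) b.span_eq
  rwa [Submodule.map_span, ← Set.range_comp, Submodule.map_top, Submodule.range_subtype] at this

theorem ιMulti_map {E' : Type*} [AddCommGroup E'] [Module F E'] {n : ℕ} (f : E →ₗ[F] E')
    (w : Fin n → E) : exteriorPower.ιMulti F n (fun j => f (w j)) =
      exteriorPower.map n f (exteriorPower.ιMulti F n w) :=
  (exteriorPower.map_apply_ιMulti f w).symm

theorem ιMulti_ne_zero_of_linearIndependent {n : ℕ} {v : Fin n → E}
    (hv : LinearIndependent F v) : exteriorPower.ιMulti F n v ≠ 0 := by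
  intro h
  have hw : exteriorPower.ιMulti F n (Module.Basis.span hv) = 0 := by
    refine exteriorPower.map_injective_field (n := n)
      (f := (Submodule.span F (Set.range v)).subtype)
      (Submodule.subtype_injective _) ?_
    rw [exteriorPower.map_apply_ιMulti, map_zero, ← h]
    congr 1
    funext i
    simp [Module.Basis.span_apply hv i]
  have := congrArg (exteriorPower.alternatingMapLinearEquiv (Module.Basis.span hv).det) hw
  rw [exteriorPower.alternatingMapLinearEquiv_apply_ιMulti, map_zero,
    Module.Basis.det_self] at this
  exact one_ne_zero this

/-- A nonzero decomposable vector determines its span: wedging `w j` onto `w` gives zero, whereas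
wedging it onto `v` would give a nonzero vector if `w j` lay outside the span. -/
theorem mem_span_of_ιMulti_eq_smul {n : ℕ} {v w : Fin n → E} {d : F}
    (hv : LinearIndependent F v) (hd : d ≠ 0)
    (h : exteriorPower.ιMulti F n w = d • exteriorPower.ιMulti F n v) (j : Fin n) :
    w j ∈ Submodule.span F (Set.range v) := by
  by_contra hj
  have hcons : LinearIndependent F (Fin.cons (w j) v : Fin (n + 1) → E) :=
    linearIndependent_finCons.mpr ⟨hv, hj⟩
  apply ιMulti_ne_zero_of_linearIndependent hcons
  apply Subtype.ext
  have hc (u : Fin n → E) : ExteriorAlgebra.ιMulti F (n + 1) (Fin.cons (w j) u : Fin (n + 1) → E) =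
      ExteriorAlgebra.ι F (w j) * ExteriorAlgebra.ιMulti F n u := by
    rw [ExteriorAlgebra.ιMulti_succ_apply]
    rfl
  have h0 : ExteriorAlgebra.ιMulti F (n + 1) (Fin.cons (w j) w : Fin (n + 1) → E) = 0 :=
    (ExteriorAlgebra.ιMulti F (n + 1)).map_eq_zero_of_eq _ (i := 0) (j := j.succ) (by simp)
      (Fin.succ_ne_zero j).symm
  have h' := congrArg Subtype.val h
  simp only [exteriorPower.ιMulti_apply_coe, Submodule.coe_smul] at h'
  rw [hc, h', mul_smul_comm] at h0
  rw [exteriorPower.ιMulti_apply_coe, hc]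
  exact (smul_eq_zero.mp h0).resolve_left hd

theorem alternatingMap_eq_det_smul {E' : Type*} [AddCommGroup E'] [Module F E'] {n : ℕ}
    (b : Module.Basis (Fin n) F E') (h : E' [⋀^Fin n]→ₗ[F] E) (w : Fin n → E') :
    h w = b.det w • h b := by
  have key : h = (LinearMap.toSpanSingleton F E (h b)).compAlternatingMap b.det := by
    refine Module.Basis.ext_alternating b fun i hi => ?_
    let σ : Equiv.Perm (Fin n) := Equiv.ofBijective i (Finite.injective_iff_bijective.1 hi)
    change h (b ∘ σ) = LinearMap.toSpanSingleton F E (h b) (b.det (b ∘ σ))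
    rw [AlternatingMap.map_perm, AlternatingMap.map_perm, Module.Basis.det_self, map_zsmul_unit,
      LinearMap.toSpanSingleton_apply, one_smul]
  exact congrArg (fun g : E' [⋀^Fin n]→ₗ[F] E => g w) key

theorem ιMulti_map_comp_basis {E' : Type*} [AddCommGroup E'] [Module F E'] {n : ℕ}
    (b : Module.Basis (Fin n) F E') (g : E' →ₗ[F] E) (f : Module.End F E') :
    exteriorPower.ιMulti F n (fun j => g (f (b j))) =
      LinearMap.det f • exteriorPower.ιMulti F n (fun j => g (b j)) := by
  have h := alternatingMap_eq_det_smul b ((exteriorPower.ιMulti F n).compLinearMap g) (f ∘ b)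
  rwa [Module.Basis.det_comp, Module.Basis.det_self, mul_one] at h

end ExteriorPower
end TwoSided

namespace TwoSided

/-! ### A criterion for a module to be cyclic -/

section Cyclic

variable {F R B M : Type*} [Field F] [CommRing R] [CommRing B] [Algebra F R] [Algebra F B]
  [AddCommGroup M] [Module F M] [Module R M] [IsScalarTower F R M]

/-- If an ideal `P` is such that `P • M = M`, some element of `P` acts injectively on `M`. -/
theorem exists_mem_injective_of_smul_top_eq_top [Module.Finite R M] {P : Ideal R}
    (hP : P • (⊤ : Submodule R M) = ⊤) : ∃ a ∈ P, Function.Injective (fun x : M => a • x) := by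
  obtain ⟨r, hr, hr0⟩ := Submodule.exists_sub_one_mem_and_smul_eq_zero_of_fg_of_le_smul P
    (⊤ : Submodule R M) Module.Finite.fg_top hP.ge
  -- Since `r` kills `M`, the element `1 - r` of `P` acts as the identity.
  refine ⟨1 - r, by simpa using neg_mem hr, fun x y hxy => ?_⟩
  simpa [sub_smul, hr0 x trivial, hr0 y trivial] using hxy

/-- By the Chinese remainder theorem some `u` is nonzero in every `M / P i M`. These are vector
spaces over the fields `R / P i`, so an `r` outside `P i` cannot kill `u`. -/
theorem exists_forall_smul_notMem {ι : Type*} [Finite ι] {P : ι → Ideal R}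
    (hP : ∀ i, (P i).IsMaximal) (hinj : Function.Injective P)
    (hM : ∀ i, P i • (⊤ : Submodule R M) ≠ ⊤) :
    ∃ u : M, ∀ (r : R), (∃ i, r ∉ P i) → r • u ≠ 0 := by
  classical
  cases nonempty_fintype ι
  have hco : Pairwise (Function.onFun IsCoprime P) := fun i j hij =>
    Ideal.isCoprime_of_isMaximal (fun h => hij (hinj h))
  have hex (i : ι) : ∃ x : M, x ∉ P i • (⊤ : Submodule R M) := by
    by_contra! h
    exact hM i (eq_top_iff.mpr fun x _ => h x)
  choose x hx using hex
  choose e he using fun j => Ideal.exists_forall_sub_mem_ideal hco (Pi.single j (1 : R))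
  have hu (i : ι) : ∑ j, e j • x j - x i ∈ P i • (⊤ : Submodule R M) := by
    have : ∑ j, e j • x j - x i =
        ∑ j, (e j - (Pi.single j (1 : R) : ι → R) i) • x j := by
      simp [sub_smul, Finset.sum_sub_distrib, Pi.single_apply, ite_smul]
    rw [this]
    exact Submodule.sum_mem _ fun j _ => Submodule.smul_mem_smul (he j i) trivial
  refine ⟨∑ j, e j • x j, ?_⟩
  rintro r ⟨i, hri⟩ h0
  obtain ⟨s, hs⟩ := (hP i).exists_inv hri
  obtain ⟨p, hp, hsp⟩ := hs
  apply hx i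
  have hxi : r • x i ∈ P i • (⊤ : Submodule R M) := by
    have := Submodule.smul_mem _ r (hu i)
    rw [smul_sub, h0, zero_sub] at this
    simpa using this
  have : x i = s • r • x i + p • x i := by
    rw [smul_smul, ← add_smul, hsp, one_smul]
  rw [this]
  exact add_mem (Submodule.smul_mem _ _ hxi) (Submodule.smul_mem_smul hp trivial)

/-- Let `B` be a quotient of `R` that is reduced and finite over the field `F`. If the `R`-module `M`
has the dimension of `B` and every element of `R` acting injectively on `M` becomes a unit in `B`,
then `M` is cyclic with annihilator the kernel of `R → B`. -/
theorem exists_generator [IsReduced B] [Module.Finite F B] [Module.Finite F M]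
    (ψ : R →ₐ[F] B) (hψ : Function.Surjective ψ)
    (hdim : Module.finrank F M = Module.finrank F B)
    (hunit : ∀ a : R, Function.Injective (fun x : M => a • x) → IsUnit (ψ a)) :
    ∃ u : M, (∀ r : R, r • u = 0 ↔ ψ r = 0) ∧ ∀ x : M, ∃ r : R, r • u = x := by
  have : IsArtinianRing B := IsArtinianRing.of_finite F B
  have : Module.Finite R M := Module.Finite.of_restrictScalars_finite F R M
  let P (i : MaximalSpectrum B) : Ideal R := i.asIdeal.comap ψ
  have hP (i) : (P i).IsMaximal := Ideal.comap_isMaximal_of_surjective ψ hψ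
  have hinj : Function.Injective P := fun i j h =>
    MaximalSpectrum.ext (Ideal.comap_injective_of_surjective ψ hψ h)
  obtain ⟨u, hu⟩ := exists_forall_smul_notMem (M := M) hP hinj fun i hi => by
    obtain ⟨a, ha, hai⟩ := exists_mem_injective_of_smul_top_eq_top hi
    exact i.isMaximal.ne_top (Ideal.eq_top_of_isUnit_mem _ ha (hunit a hai))
  have hker (r : R) (hr : r • u = 0) : ψ r = 0 := by
    have hr' : ∀ i, r ∈ P i := by
      by_contra! h
      exact hu r h hr
    -- In an Artinian ring the Jacobson radical is the nilradical, which is zero here because `B` is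
    -- reduced.
    have hj : ψ r ∈ (⊥ : Ideal B).jacobson :=
      Ideal.mem_sInf.mpr fun {J} hJ => hr' ⟨J, hJ.2⟩
    rw [IsArtinianRing.jacobson_eq_radical] at hj
    obtain ⟨n, hn⟩ := hj
    exact IsNilpotent.eq_zero ⟨n, hn⟩
  -- The submodule `R u ≅ R / ker f` surjects onto `B`, so `dim B ≤ dim R u ≤ dim M = dim B`;
  -- equality gives both generation and the annihilator.
  let f : R →ₗ[F] M := (LinearMap.toSpanSingleton R M u).restrictScalars F
  have hle : LinearMap.ker f ≤ LinearMap.ker ψ.toLinearMap := hker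
  let g : (R ⧸ LinearMap.ker f) →ₗ[F] B := (LinearMap.ker f).liftQ ψ.toLinearMap hle
  have hg : Function.Surjective g := fun b => by
    obtain ⟨r, rfl⟩ := hψ b
    exact ⟨Submodule.Quotient.mk r, rfl⟩
  let e := f.quotKerEquivRange
  have : Module.Finite F (R ⧸ LinearMap.ker f) := Module.Finite.equiv e.symm
  have h1 : Module.finrank F B ≤ Module.finrank F (R ⧸ LinearMap.ker f) :=
    LinearMap.finrank_le_finrank_of_surjective hg
  have h2 : Module.finrank F (R ⧸ LinearMap.ker f) = Module.finrank F (LinearMap.range f) :=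
    e.finrank_eq
  have h3 := Submodule.finrank_le (LinearMap.range f)
  have hrange : LinearMap.range f = ⊤ := Submodule.eq_top_of_finrank_eq (by lia)
  have hgi : Function.Injective g :=
    (LinearMap.injective_iff_surjective_of_finrank_eq_finrank (by lia)).mpr hg
  refine ⟨u, fun r => ⟨hker r, fun hr => ?_⟩, fun x => LinearMap.range_eq_top.mp hrange x⟩
  have : (Submodule.Quotient.mk r : R ⧸ LinearMap.ker f) = 0 := hgi (by rw [map_zero]; exact hr)
  exact (Submodule.Quotient.mk_eq_zero _).mp this

/-- Cyclic modules with the same annihilator are isomorphic. -/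
theorem nonempty_linearEquiv_of_generators {N : Type*} [AddCommGroup N] [Module R N]
    {u : M} {w : N} (h : ∀ r : R, r • u = 0 ↔ r • w = 0)
    (hu : ∀ x : M, ∃ r : R, r • u = x) (hw : ∀ x : N, ∃ r : R, r • w = x) :
    Nonempty (M ≃ₗ[R] N) := by
  have hker : LinearMap.ker (LinearMap.toSpanSingleton R M u) =
      LinearMap.ker (LinearMap.toSpanSingleton R N w) := Submodule.ext h
  exact ⟨((LinearMap.toSpanSingleton R M u).quotKerEquivOfSurjective hu).symm ≪≫ₗ
    Submodule.quotEquivOfEq _ _ hker ≪≫ₗ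
    (LinearMap.toSpanSingleton R N w).quotKerEquivOfSurjective hw⟩

end Cyclic
end TwoSided

namespace TwoSided

/-! ### Base change of two-sided vector spaces -/

section BaseChange

variable {k K : Type*} [Field k] [Field K] [Algebra k K]
  {V V' : Type*} [AddCommGroup V] [Module K V] [Module (K ⊗[k] K) V] [IsScalarTower K (K ⊗[k] K) V]
  [AddCommGroup V'] [Module K V'] [Module (K ⊗[k] K) V'] [IsScalarTower K (K ⊗[k] K) V']
  (F : Type*) [CommRing F] [Algebra k F] [Algebra K F] [IsScalarTower k K F]

/-- The base change of a morphism of two-sided vector spaces. -/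
noncomputable def baseChangeMap (f : V →ₗ[K ⊗[k] K] V') :
    (F ⊗[K] V) →ₗ[F ⊗[k] K] (F ⊗[K] V') where
  toFun := (f.restrictScalars K).baseChange F
  map_add' := map_add _
  map_smul' a y := by
    induction y with
    | zero => simp
    | add y z hy hz => simp only [smul_add, map_add, hy, hz]
    | tmul s v =>
      induction a with
      | zero => simp
      | add a b ha hb => simp only [add_smul, map_add, ha, hb]
      | tmul r x => simp [tmul_smul_tmul]

theorem baseChangeMap_tmul (f : V →ₗ[K ⊗[k] K] V') (r : F) (v : V) :
    baseChangeMap F f (r ⊗ₜ v) = r ⊗ₜ f v := rfl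

/-- The base change of an isomorphism of two-sided vector spaces. -/
noncomputable def baseChangeEquiv (e : V ≃ₗ[K ⊗[k] K] V') :
    (F ⊗[K] V) ≃ₗ[F ⊗[k] K] (F ⊗[K] V') :=
  { baseChangeMap F e.toLinearMap with
    invFun := baseChangeMap F e.symm.toLinearMap
    left_inv := fun y => by
      induction y with
      | zero => simp
      | add y z hy hz => simp_all
      | tmul s v => simp [baseChangeMap_tmul]
    right_inv := fun y => by
      induction y with
      | zero => simp
      | add y z hy hz => simp_all
      | tmul s v => simp [baseChangeMap_tmul] }

theorem actionHom_apply (a : F ⊗[k] K) (y : F ⊗[K] V) : actionHom k K V F a y = a • y := rfl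

theorem det_actionHom_eq (e : V ≃ₗ[K ⊗[k] K] V') (a : F ⊗[k] K) :
    LinearMap.det (actionHom k K V F a) = LinearMap.det (actionHom k K V' F a) := by
  rw [← LinearMap.det_conj (actionHom k K V F a) ((baseChangeEquiv F e).restrictScalars F)]
  congr 1
  refine LinearMap.ext fun z => ?_
  exact ((baseChangeEquiv F e).map_smul a _).trans
    (congrArg (a • ·) ((baseChangeEquiv F e).apply_symm_apply z))

end BaseChange

/-! ### The quotient algebra `F ⊗[K] L` of `F ⊗[k] K` -/

section Quotient

variable {k K : Type*} [Field k] [Field K] [Algebra k K]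
  (F : Type*) [Field F] [Algebra k F] [Algebra K F] [IsScalarTower k K F]
  (L : Type*) [CommRing L] [Algebra K L] [Algebra (K ⊗[k] K) L] [IsScalarTower K (K ⊗[k] K) L]

theorem smul_eq_smul_one_mul (a : F ⊗[k] K) (y : F ⊗[K] L) :
    a • y = (a • (1 : F ⊗[K] L)) * y := by
  induction a with
  | zero => rw [zero_smul, zero_smul, zero_mul]
  | add a b ha hb => rw [add_smul, add_smul, add_mul, ← ha, ← hb]
  | tmul r x =>
    induction y with
    | zero => rw [smul_zero, mul_zero]
    | add y z hy hz => rw [smul_add, mul_add, hy, hz]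
    | tmul s v =>
      rw [Algebra.TensorProduct.one_def, tmul_smul_tmul, tmul_smul_tmul,
        Algebra.TensorProduct.tmul_mul_tmul, mul_one, smul_mul_assoc, one_mul]

/-- For a quotient `L` of `K ⊗ K`, the homomorphism `F ⊗[k] K → F ⊗[K] L` that gives the module
structure of the target. -/
noncomputable def toBaseChangeQuotient : F ⊗[k] K →ₐ[F] F ⊗[K] L :=
  AlgHom.ofLinearMap ((LinearMap.toSpanSingleton (F ⊗[k] K)
      (F ⊗[K] L) 1).restrictScalars F) (one_smul (F ⊗[k] K) (1 : F ⊗[K] L)) fun a b => by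
    change (a * b) • (1 : F ⊗[K] L) = (a • 1) * (b • 1)
    rw [mul_smul, smul_eq_smul_one_mul]

theorem toBaseChangeQuotient_apply (a : F ⊗[k] K) :
    toBaseChangeQuotient F L a = a • (1 : F ⊗[K] L) := rfl

theorem toBaseChangeQuotient_surjective
    (hL : Function.Surjective (algebraMap (K ⊗[k] K) L)) :
    Function.Surjective (toBaseChangeQuotient (k := k) (K := K) F L) := by
  rw [← AlgHom.range_eq_top, eq_top_iff]
  rintro y -
  induction y with
  | zero => exact zero_mem _
  | add y z hy hz => exact add_mem (hy) (hz)
  | tmul r l =>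
    obtain ⟨a, rfl⟩ := hL l
    induction a with
    | zero => rw [map_zero, TensorProduct.tmul_zero]; exact zero_mem _
    | add a b ha hb => rw [map_add, TensorProduct.tmul_add]; exact add_mem ha hb
    | tmul x y =>
      refine ⟨(r * algebraMap K F x) ⊗ₜ y, ?_⟩
      change toBaseChangeQuotient F L ((r * algebraMap K F x) ⊗ₜ y) = _
      have h : algebraMap (K ⊗[k] K) L (x ⊗ₜ[k] y) = x • (((1 : K) ⊗ₜ[k] y) • (1 : L)) := by
        rw [← smul_assoc, TensorProduct.smul_tmul', smul_eq_mul, mul_one,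
          Algebra.smul_def, mul_one]
      rw [toBaseChangeQuotient_apply, Algebra.TensorProduct.one_def, tmul_smul_tmul, mul_one, h,
        TensorProduct.tmul_smul x, TensorProduct.smul_tmul', Algebra.smul_def x r, mul_comm]

end Quotient

/-- Perfectness makes `L / K` separable, hence unramified; this survives base change, and unramified
algebras over a field are reduced. -/
theorem isReduced_tensorProduct {K L : Type*} (F : Type*) [Field K] [PerfectField K] [Field L]
    [Algebra K L] [FiniteDimensional K L] [Field F] [Algebra K F] : IsReduced (F ⊗[K] L) := by
  have : Algebra.FormallyUnramified K L := Algebra.FormallyUnramified.of_isSeparable K L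
  exact Algebra.FormallyUnramified.isReduced_of_field F (F ⊗[K] L)

end TwoSided

namespace TwoSided

/-! ### Families generated by invariants -/

section Generated

variable {k K : Type*} [Field k] [Field K] [Algebra k K]
  {F : Type*} [Field F] [Algebra k F] [Algebra K F] [IsScalarTower k K F]
  {S V : Type*}
  [AddCommGroup S] [Module K S] [Module (K ⊗[k] K) S] [IsScalarTower K (K ⊗[k] K) S]
  [AddCommGroup V] [Module K V] [Module (K ⊗[k] K) V] [IsScalarTower K (K ⊗[k] K) V]

/-- If all invariant subspaces of dimension `n` are isomorphic to `S`, the top exterior power of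
each of them is acted on through the determinant of the action on `S`. -/
theorem ιMulti_smul_of_isBasisOfInvariant {n : ℕ}
    (hS : ∀ U : Submodule (K ⊗[k] K) V, Module.finrank K U = n → Nonempty (U ≃ₗ[K ⊗[k] K] S))
    {v : Fin n → V} (hv : IsBasisOfInvariant k K V v) (a : F ⊗[k] K) :
    exteriorPower.ιMulti F n (fun j => a • ((1 : F) ⊗ₜ[K] v j)) =
      LinearMap.det (actionHom k K S F a) •
        exteriorPower.ιMulti F n (fun j => (1 : F) ⊗ₜ[K] v j) := by
  obtain ⟨hli, U, hU⟩ := hv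
  let b : Module.Basis (Fin n) K U := (Module.Basis.span hli).map
    (LinearEquiv.ofEq _ _ hU.symm ≪≫ₗ
      (U.restrictScalarsEquiv K (K ⊗[k] K) V).restrictScalars K)
  have hb (j) : (b j : V) = v j := congrArg Subtype.val (Module.Basis.span_apply hli j)
  obtain ⟨e⟩ := hS U (by rw [Module.finrank_eq_card_basis b, Fintype.card_fin])
  have hg (j) : baseChangeMap F U.subtype (b.baseChange F j) = (1 : F) ⊗ₜ[K] v j := by
    rw [Module.Basis.baseChange_apply, baseChangeMap_tmul, Submodule.subtype_apply, hb]
  have h := ιMulti_map_comp_basis (b.baseChange F)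
    ((baseChangeMap F U.subtype).restrictScalars F) (actionHom k K U F a)
  simpa only [LinearMap.restrictScalars_apply, actionHom_apply, map_smul, hg,
    det_actionHom_eq F e] using h

/-- The scalar on each summand of the generator does not depend on the summand, so it is also the
scalar on the line they generate. -/
theorem ιMulti_smul_basis_of_generatedByInvariants {n : ℕ}
    (hS : ∀ U : Submodule (K ⊗[k] K) V, Module.finrank K U = n → Nonempty (U ≃ₗ[K ⊗[k] K] S))
    {M : Submodule F (F ⊗[K] V)} (hM : GeneratedByInvariants k K V F n M)
    (b : Fin n → M) (a : F ⊗[k] K) :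
    exteriorPower.ιMulti F n (fun j => a • (b j : F ⊗[K] V)) =
      LinearMap.det (actionHom k K S F a) •
        exteriorPower.ιMulti F n (fun j => (b j : F ⊗[K] V)) := by
  obtain ⟨N, r, v, hv, hrange⟩ := hM
  have hmem : exteriorPower.ιMulti F n (fun j => (b j : F ⊗[K] V)) ∈
      LinearMap.range (exteriorPower.map n M.subtype) :=
    ⟨exteriorPower.ιMulti F n b, exteriorPower.map_apply_ιMulti _ _⟩
  rw [hrange] at hmem
  obtain ⟨c, hc⟩ := Submodule.mem_span_singleton.mp hmem
  have hmap (w : Fin n → F ⊗[K] V) : exteriorPower.ιMulti F n (fun j => a • w j) =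
      exteriorPower.map n (actionHom k K V F a) (exteriorPower.ιMulti F n w) :=
    ιMulti_map (actionHom k K V F a) w
  rw [hmap, ← hc, map_smul (exteriorPower.map n (actionHom k K V F a)), map_sum, smul_comm _ c]
  refine congrArg (HSMul.hSMul c) ?_
  rw [Finset.smul_sum]
  refine Finset.sum_congr rfl fun i _ => ?_
  rw [map_smul (exteriorPower.map n (actionHom k K V F a)), ← hmap,
    ιMulti_smul_of_isBasisOfInvariant hS (hv i), smul_comm]

theorem exists_restrictScalars_eq_of_gFamilies {n : ℕ}
    (hS : ∀ U : Submodule (K ⊗[k] K) V, Module.finrank K U = n → Nonempty (U ≃ₗ[K ⊗[k] K] S))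
    {M : Submodule F (F ⊗[K] V)} (hM : M ∈ gFamilies k K V F n) :
    ∃ N : Submodule (F ⊗[k] K) (F ⊗[K] V), N.restrictScalars F = M := by
  obtain ⟨⟨⟨b⟩, -⟩, hgen⟩ := hM
  have hli := linearIndependent_coe_basis b
  have hspan := span_range_coe_basis b
  have hx (x : K) (y : F ⊗[K] V) (hy : y ∈ M) : ((1 : F) ⊗ₜ[k] x) • y ∈ M := by
    -- The determinant of a general `a` may vanish, so stability is proved for the units `1 ⊗ x`,
    -- which together with `F` generate the action.
    rcases eq_or_ne x 0 with rfl | hx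
    · simp
    have hu : IsUnit ((1 : F) ⊗ₜ[k] x) :=
      (IsUnit.mk0 x hx).map (Algebra.TensorProduct.includeRight : K →ₐ[k] F ⊗[k] K)
    have hd : LinearMap.det (actionHom k K S F ((1 : F) ⊗ₜ[k] x)) ≠ 0 :=
      ((hu.map (actionHom k K S F)).map LinearMap.det).ne_zero
    have hb := mem_span_of_ιMulti_eq_smul hli hd
      (ιMulti_smul_basis_of_generatedByInvariants hS hgen b ((1 : F) ⊗ₜ[k] x))
    rw [hspan] at hb
    have hle : M ≤ M.comap (actionHom k K V F ((1 : F) ⊗ₜ[k] x)) := by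
      conv_lhs => rw [← hspan]
      rw [Submodule.span_le]
      rintro _ ⟨j, rfl⟩
      exact hb j
    exact hle hy
  suffices h : ∀ (a : F ⊗[k] K) (y : F ⊗[K] V), y ∈ M → a • y ∈ M from
    ⟨{ M with smul_mem' := fun a y hy => h a y hy }, rfl⟩
  intro a y hy
  induction a with
  | zero => rw [zero_smul]; exact M.zero_mem
  | add a a' ha ha' => rw [add_smul]; exact M.add_mem ha ha'
  | tmul r x =>
    have : r ⊗ₜ[k] x = r • ((1 : F) ⊗ₜ[k] x) := by
      rw [TensorProduct.smul_tmul', smul_eq_mul, mul_one]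
    rw [this, smul_assoc]
    exact M.smul_mem r (hx x y hy)

theorem isoBaseChange_of_gFamilies [PerfectField K] [Module.Finite K S]
    {L : Type*} [Field L] [Algebra K L] [Algebra (K ⊗[k] K) L] [IsScalarTower K (K ⊗[k] K) L]
    (hL : Function.Surjective (algebraMap (K ⊗[k] K) L)) (e : S ≃ₗ[K ⊗[k] K] L)
    (hS : ∀ U : Submodule (K ⊗[k] K) V, Module.finrank K U = Module.finrank K S →
      Nonempty (U ≃ₗ[K ⊗[k] K] S))
    {M : Submodule F (F ⊗[K] V)} (hM : M ∈ gFamilies k K V F (Module.finrank K S)) :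
    IsoBaseChange k K V F S M := by
  obtain ⟨N, rfl⟩ := exists_restrictScalars_eq_of_gFamilies hS hM
  refine ⟨N, rfl, ?_⟩
  obtain ⟨⟨⟨b⟩, -⟩, hgen⟩ := hM
  let b' : Module.Basis (Fin (Module.finrank K S)) F N :=
    b.map ((N.restrictScalarsEquiv F (F ⊗[k] K) (F ⊗[K] V)).restrictScalars F)
  have : Module.Finite F N := Module.Finite.of_basis b'
  have : Module.Finite K L := Module.Finite.equiv (e.restrictScalars K)
  have := isReduced_tensorProduct (K := K) (L := L) F
  have hdim : Module.finrank F N = Module.finrank F (F ⊗[K] L) := by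
    rw [Module.finrank_eq_card_basis b', Fintype.card_fin, Module.finrank_baseChange]
    exact (e.restrictScalars K).finrank_eq
  -- Injectivity keeps the wedge of a basis nonzero, so the determinant on `F ⊗[K] S`, equal to that
  -- on `F ⊗[K] L`, is nonzero. A preimage of `1` under `a` is then an inverse.
  have hunit (a : F ⊗[k] K) (ha : Function.Injective (fun x : N => a • x)) :
      IsUnit (toBaseChangeQuotient F L a) := by
    let f : N →ₗ[F] F ⊗[K] V := (actionHom k K V F a).comp (N.subtype.restrictScalars F)
    have hf : Function.Injective f := fun x y hxy => ha (Subtype.ext hxy)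
    have h0 := ιMulti_ne_zero_of_linearIndependent 
      (linearIndependent_map_basis (E := F ⊗[K] V) (E' := N) b' f hf)
    have h1 := ιMulti_smul_basis_of_generatedByInvariants hS hgen
      (fun j => ⟨(b' j).1, (b' j).2⟩) a
    rw [show (fun j => f (b' j)) = fun j => a • (b' j : F ⊗[K] V) from rfl, h1] at h0
    have hd := left_ne_zero_of_smul h0
    rw [det_actionHom_eq F e] at hd
    obtain ⟨y, hy⟩ := (LinearMap.equivOfDetNeZero _ hd).surjective (1 : F ⊗[K] L)
    refine IsUnit.of_mul_eq_one y ?_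
    rw [toBaseChangeQuotient_apply, ← smul_eq_smul_one_mul]
    exact hy
  obtain ⟨u, hu, hu'⟩ := exists_generator (M := N) (toBaseChangeQuotient F L)
    (toBaseChangeQuotient_surjective F L hL) hdim hunit
  obtain ⟨e'⟩ := nonempty_linearEquiv_of_generators (w := (1 : F ⊗[K] L)) hu hu'
    (toBaseChangeQuotient_surjective F L hL)
  exact ⟨e' ≪≫ₗ (baseChangeEquiv F e).symm⟩

end Generated
end TwoSided

namespace TwoSided

/-! ### Homogeneous modules and multiplicities -/

section Homogeneous

variable {A : Type*} [CommRing A] {S S' V : Type*} [AddCommGroup S] [Module A S]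
  [AddCommGroup S'] [Module A S'] [AddCommGroup V] [Module A V]

theorem IsHomogeneous.congr (e : S ≃ₗ[A] S') (h : IsHomogeneous A S V) : IsHomogeneous A S' V :=
  fun P Q hQ => (h P Q hQ).map (·.trans e)

theorem IsHomogeneous.nonempty_linearEquiv (h : IsHomogeneous A S V) (U : Submodule A V)
    [IsSimpleModule A U] : Nonempty (U ≃ₗ[A] S) := by
  let e := (Submodule.quotEquivOfEqBot (⊥ : Submodule A V) rfl).symm
  let f := e.submoduleMap U
  have : IsSimpleModule A (U.map (e : V →ₗ[A] V ⧸ (⊥ : Submodule A V))) :=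
    IsSimpleModule.congr f.symm
  exact (h ⊥ _ this).map f.trans

theorem smul_eq_zero_of_linearEquiv_quotient {I : Ideal A} (e : V ≃ₗ[A] A ⧸ I) {a : A}
    (ha : a ∈ I) (v : V) : a • v = 0 := by
  have h : a ∈ Module.annihilator A V := by
    rwa [e.annihilator_eq, Ideal.annihilator_quotient]
  exact Module.mem_annihilator.mp h v

/-- The chain `𝔪 ^ n V` stabilizes at some `W = 𝔪 W`, and Nakayama gives `r ≡ 1` mod `𝔪` killing
`W`. A simple submodule of `W` would be a copy of `A ⧸ 𝔪`, on which `r` acts as the identity. -/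
theorem IsHomogeneous.exists_pow_smul_eq_zero [IsArtinian A V] [IsNoetherian A V] {𝔪 : Ideal A}
    (h : IsHomogeneous A (A ⧸ 𝔪) V) : ∃ n : ℕ, ∀ a ∈ 𝔪 ^ n, ∀ v : V, a • v = 0 := by
  let f : ℕ →o (Submodule A V)ᵒᵈ :=
    ⟨fun n => OrderDual.toDual (𝔪 ^ n • (⊤ : Submodule A V)),
      fun i j hij => Submodule.smul_mono_left (Ideal.pow_le_pow_right hij)⟩
  obtain ⟨n, hn⟩ := IsArtinian.monotone_stabilizes f
  have hW : 𝔪 ^ n • (⊤ : Submodule A V) ≤ 𝔪 • (𝔪 ^ n • (⊤ : Submodule A V)) := by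
    rw [← mul_smul, ← pow_succ']
    exact le_of_eq (congrArg OrderDual.ofDual (hn (n + 1) n.le_succ))
  obtain ⟨r, hr, hr0⟩ := Submodule.exists_sub_one_mem_and_smul_eq_zero_of_fg_of_le_smul 𝔪 _
    (IsNoetherian.noetherian _) hW
  rcases eq_bot_or_exists_atom_le (𝔪 ^ n • (⊤ : Submodule A V)) with hbot | ⟨U, hU, hUW⟩
  · refine ⟨n, fun a ha v => ?_⟩
    have : a • v ∈ 𝔪 ^ n • (⊤ : Submodule A V) := Submodule.smul_mem_smul ha trivial
    rwa [hbot] at this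
  · have := isSimpleModule_iff_isAtom.mpr hU
    obtain ⟨e⟩ := h.nonempty_linearEquiv U
    refine absurd (eq_bot_iff.mpr fun u hu => ?_) hU.1
    have h1 : (r - 1) • (⟨u, hu⟩ : U) = 0 := smul_eq_zero_of_linearEquiv_quotient e hr _
    have h2 : (r - 1) • u = 0 := congrArg Subtype.val h1
    rw [sub_smul, hr0 u (hUW hu), one_smul, zero_sub, neg_eq_zero] at h2
    exact h2

/-- A simple subquotient `A ⧸ I` has a generator that lifts to `V`, so `𝔪 ^ n ≤ I` for some `n`,
which forces `I = 𝔪`. -/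
theorem isHomogeneous_of_forall_exists_pow {𝔪 : Ideal A} [𝔪.IsMaximal]
    (h : ∀ v : V, ∃ n : ℕ, ∀ a ∈ 𝔪 ^ n, a • v = 0) : IsHomogeneous A (A ⧸ 𝔪) V := by
  intro P Q hQ
  obtain ⟨I, hI, ⟨e⟩⟩ := isSimpleModule_iff_quot_maximal.mp hQ
  obtain ⟨v, hv⟩ := Submodule.Quotient.mk_surjective P (e.symm 1 : Q).1
  obtain ⟨n, hn⟩ := h v
  have hle : 𝔪 ^ n ≤ I := fun a ha => by
    have h0 : a • e.symm 1 = 0 := by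
      apply Subtype.ext
      rw [Submodule.coe_smul, ← hv, ← Submodule.Quotient.mk_smul, hn a ha]
      rfl
    rw [← map_smul, LinearEquiv.map_eq_zero_iff, Algebra.smul_def, mul_one] at h0
    exact Ideal.Quotient.eq_zero_iff_mem.mp h0
  have : 𝔪 = I := ‹𝔪.IsMaximal›.eq_of_le hI.ne_top (hI.isPrime.le_of_pow_le hle)
  subst this
  exact ⟨e⟩

/-- Being killed by a power of `𝔪` is a condition on single vectors that visibly passes to sums of
submodules. -/
theorem isHomogeneous_homogeneousComponent [IsArtinian A V] [IsNoetherian A V] (𝔪 : Ideal A)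
    [𝔪.IsMaximal] : IsHomogeneous A (A ⧸ 𝔪) (homogeneousComponent A (A ⧸ 𝔪) V) := by
  refine isHomogeneous_of_forall_exists_pow fun v => ?_
  suffices h : ∀ v ∈ homogeneousComponent A (A ⧸ 𝔪) V, ∃ n : ℕ, ∀ a ∈ 𝔪 ^ n, a • v = 0 by
    obtain ⟨n, hn⟩ := h v v.2
    exact ⟨n, fun a ha => Subtype.ext (hn a ha)⟩
  intro v hv
  rw [homogeneousComponent, sSup_eq_iSup'] at hv
  refine Submodule.iSup_induction _ (motive := fun v => ∃ n : ℕ, ∀ a ∈ 𝔪 ^ n, a • v = 0) hv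
    (fun U u hu => ?_) ⟨0, fun a _ => smul_zero a⟩ ?_
  · obtain ⟨n, hn⟩ := IsHomogeneous.exists_pow_smul_eq_zero U.2
    exact ⟨n, fun a ha => congrArg Subtype.val (hn a ha ⟨u, hu⟩)⟩
  · rintro x y ⟨i, hi⟩ ⟨j, hj⟩
    refine ⟨max i j, fun a ha => ?_⟩
    rw [smul_add, hi a (Ideal.pow_le_pow_right (le_max_left i j) ha),
      hj a (Ideal.pow_le_pow_right (le_max_right i j) ha), add_zero]

/-- `U` is nonzero, so it contains a simple submodule; that is a copy of `S` and fills `U` by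
dimension. -/
theorem IsHomogeneous.nonempty_linearEquiv_of_finrank_eq {K : Type*} [Field K] [Algebra K A]
    [Module K S] [IsScalarTower K A S] [Module K V] [IsScalarTower K A V] [Module.Finite K S]
    [Module.Finite K V] [IsSimpleModule A S]
    (h : IsHomogeneous A S V) (U : Submodule A V)
    (hU : Module.finrank K U = Module.finrank K S) : Nonempty (U ≃ₗ[A] S) := by
  have : IsArtinian A V := isArtinian_of_tower K inferInstance
  have := IsSimpleModule.nontrivial A S
  rcases eq_bot_or_exists_atom_le U with rfl | ⟨T, hT, hTU⟩
  · have hpos : 0 < Module.finrank K S := Module.finrank_pos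
    rw [← hU] at hpos
    exact absurd (Module.finrank_zero_of_subsingleton (R := K) (M := (⊥ : Submodule A V))) hpos.ne'
  · have := isSimpleModule_iff_isAtom.mpr hT
    obtain ⟨e⟩ := h.nonempty_linearEquiv T
    have hTU' : T.restrictScalars K = U.restrictScalars K :=
      Submodule.eq_of_le_of_finrank_eq hTU ((e.restrictScalars K).finrank_eq.trans hU.symm)
    obtain rfl := Submodule.restrictScalars_injective K A V hTU'
    exact ⟨e⟩

theorem multiplicity_eq_one [IsSimpleModule A S] (𝔪 : MaximalSpectrum A)
    (e : S ≃ₗ[A] A ⧸ 𝔪.asIdeal) : multiplicity A S 𝔪 = 1 := by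
  have : 𝔪.asIdeal.IsMaximal := 𝔪.isMaximal
  have htop : homogeneousComponent A (A ⧸ 𝔪.asIdeal) S = ⊤ := by
    refine eq_top_iff.mpr (le_sSup (isHomogeneous_of_forall_exists_pow fun v => ⟨1, fun a ha => ?_⟩))
    rw [pow_one] at ha
    exact Subtype.ext (smul_eq_zero_of_linearEquiv_quotient e ha v.1)
  rw [multiplicity, htop, Module.length_top, Module.length_eq_one, ENat.toNat_one]

theorem multiplicity_eq_zero [IsSimpleModule A S] {𝔪 𝔫 : MaximalSpectrum A}
    (e : S ≃ₗ[A] A ⧸ 𝔪.asIdeal) (hne : 𝔫 ≠ 𝔪) : multiplicity A S 𝔫 = 0 := by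
  have hbot : homogeneousComponent A (A ⧸ 𝔫.asIdeal) S = ⊥ := by
    refine sSup_eq_bot.mpr fun U hU => (eq_bot_or_eq_top U).resolve_right ?_
    rintro rfl
    have : IsSimpleModule A (⊤ : Submodule A S) := IsSimpleModule.congr Submodule.topEquiv
    have : IsSimpleModule A (⊤ : Submodule A (⊤ : Submodule A S)) :=
      IsSimpleModule.congr Submodule.topEquiv
    obtain ⟨f⟩ := IsHomogeneous.nonempty_linearEquiv hU (⊤ : Submodule A (⊤ : Submodule A S))
    have h := (e.symm ≪≫ₗ Submodule.topEquiv.symm ≪≫ₗ Submodule.topEquiv.symm ≪≫ₗ f).annihilator_eq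
    rw [Ideal.annihilator_quotient, Ideal.annihilator_quotient] at h
    exact hne (MaximalSpectrum.ext h.symm)
  rw [multiplicity, hbot, Module.length_eq_zero, ENat.toNat_zero]

end Homogeneous
end TwoSided

namespace TwoSided

/-! ### From homogeneous spaces to arbitrary ones -/

section Points

variable {k K : Type*} [Field k] [Field K] [Algebra k K]
  {F : Type*} [Field F] [Algebra k F] [Algebra K F] [IsScalarTower k K F]
  {S V : Type*}
  [AddCommGroup S] [Module K S] [Module (K ⊗[k] K) S] [IsScalarTower K (K ⊗[k] K) S]
  [AddCommGroup V] [Module K V] [Module (K ⊗[k] K) V] [IsScalarTower K (K ⊗[k] K) V]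

theorem isoBaseChange_of_isHomogeneous [PerfectField K] [Module.Finite K S] [Module.Finite K V]
    [IsSimpleModule (K ⊗[k] K) S] (hV : IsHomogeneous (K ⊗[k] K) S V)
    {M : Submodule F (F ⊗[K] V)} (hM : M ∈ gFamilies k K V F (Module.finrank K S)) :
    IsoBaseChange k K V F S M := by
  obtain ⟨𝔪, h𝔪, ⟨e⟩⟩ := isSimpleModule_iff_quot_maximal.mp
    (inferInstance : IsSimpleModule (K ⊗[k] K) S)
  let _ : Field ((K ⊗[k] K) ⧸ 𝔪) := Ideal.Quotient.field 𝔪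
  exact isoBaseChange_of_gFamilies (L := (K ⊗[k] K) ⧸ 𝔪) Ideal.Quotient.mk_surjective e
    hV.nonempty_linearEquiv_of_finrank_eq hM

theorem IsoBaseChange.map {U : Submodule (K ⊗[k] K) V} {M : Submodule F (F ⊗[K] U)}
    (hM : IsoBaseChange k K U F S M) :
    IsoBaseChange k K V F S (M.map ((U.subtype.restrictScalars K).baseChange F)) := by
  obtain ⟨N, rfl, ⟨e⟩⟩ := hM
  have hinj : Function.Injective (baseChangeMap F U.subtype) :=
    Module.Flat.lTensor_preserves_injective_linearMap (M := F) (U.subtype.restrictScalars K)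
      U.subtype_injective
  exact ⟨N.map (baseChangeMap F U.subtype), rfl,
    ⟨(Submodule.equivMapOfInjective _ hinj N).symm ≪≫ₗ e⟩⟩

theorem eq_bot_of_mem_grassmannian_zero {M : Submodule F (F ⊗[K] V)}
    (hM : M ∈ grassmannian K V F 0) : M = ⊥ := by
  obtain ⟨⟨b⟩, -⟩ := hM
  rw [← span_range_coe_basis b, Set.range_eq_empty, Submodule.span_empty]

theorem isoBaseChange_total_of_gPoints [PerfectField K] [Module.Finite K S] [Module.Finite K V]
    [IsSimpleModule (K ⊗[k] K) S]
    {M : ∀ 𝔪 : MaximalSpectrum (K ⊗[k] K), Submodule F (F ⊗[K] component k K V 𝔪)}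
    (hM : M ∈ gPoints k K S V F) : IsoBaseChange k K V F S (total k K V F M) := by
  obtain ⟨I, hI, ⟨e⟩⟩ := isSimpleModule_iff_quot_maximal.mp
    (inferInstance : IsSimpleModule (K ⊗[k] K) S)
  let 𝔪 : MaximalSpectrum (K ⊗[k] K) := ⟨I, hI⟩
  have hrank : rankPart k K S 𝔪 = Module.finrank K S := by
    rw [rankPart, multiplicity_eq_one 𝔪 e, one_mul]
    exact (e.restrictScalars K).finrank_eq.symm
  have hrank' (𝔫) (h : 𝔫 ≠ 𝔪) : rankPart k K S 𝔫 = 0 := by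
    rw [rankPart, multiplicity_eq_zero (𝔪 := 𝔪) e h, zero_mul]
  -- At every other maximal ideal the prescribed rank is zero, so that summand vanishes.
  have htotal : total k K V F M =
      (M 𝔪).map (((component k K V 𝔪).subtype.restrictScalars K).baseChange F) := by
    refine le_antisymm (iSup_le fun 𝔫 => ?_) (le_iSup (fun 𝔫 => (M 𝔫).map
      (((component k K V 𝔫).subtype.restrictScalars K).baseChange F)) 𝔪)
    rcases eq_or_ne 𝔫 𝔪 with rfl | h
    · exact le_rfl
    · have h0 := (hM.2 𝔫).1
      rw [hrank' 𝔫 h] at h0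
      rw [eq_bot_of_mem_grassmannian_zero h0, Submodule.map_bot]
      exact bot_le
  rw [htotal]
  have : IsArtinian (K ⊗[k] K) V := isArtinian_of_tower K inferInstance
  have : IsNoetherian (K ⊗[k] K) V := isNoetherian_of_tower K inferInstance
  have : Module.Finite K (component k K V 𝔪) :=
    inferInstanceAs (Module.Finite K ((component k K V 𝔪).restrictScalars K))
  have hg := hM.2 𝔪
  rw [hrank] at hg
  exact (isoBaseChange_of_isHomogeneous
    ((isHomogeneous_homogeneousComponent (V := V) I).congr e.symm) hg).map

end Points
end TwoSided

theorem mainTheorem4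
    {k K F S V : Type*} [Field k] [Field K] [Field F]
    [Algebra k K] [Algebra K F] [Algebra k F] [IsScalarTower k K F]
    [AddCommGroup S] [Module K S] [Module (K ⊗[k] K) S] [IsScalarTower K (K ⊗[k] K) S]
    [AddCommGroup V] [Module K V] [Module (K ⊗[k] K) V] [IsScalarTower K (K ⊗[k] K) V]
    [Module.Finite K S] [Module.Finite K V]
    [IsSimpleModule (K ⊗[k] K) S] [PerfectField K]
    (hk : (Module.finrank K S : Cardinal) < Cardinal.mk k) :
    (TwoSided.IsHomogeneous (K ⊗[k] K) S V →
      ∀ M ∈ TwoSided.gFamilies k K V F (Module.finrank K S),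
        TwoSided.IsoBaseChange k K V F S M) ∧
    (∀ M ∈ TwoSided.gPoints k K S V F,
      TwoSided.IsoBaseChange k K V F S (TwoSided.total k K V F M)) ∧
    (∀ M ∈ TwoSided.hPoints k K S V F,
      TwoSided.IsoBaseChange k K V F S (TwoSided.total k K V F M)) :=
  ⟨fun hV _ hM => TwoSided.isoBaseChange_of_isHomogeneous hV hM,
    fun _ hM => TwoSided.isoBaseChange_total_of_gPoints hM,
    fun _ hM => TwoSided.isoBaseChange_total_of_gPoints ⟨hM.1, fun 𝔪 => (hM.2 𝔪).2⟩⟩
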